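/- Let $\ell_1^n(\ell_\infty^n)$ be $(\mathbb C^n)^n$ with basis $e_x\otimes e_a'$ ($x,a=1,\dots,n$) and norm $\|v\|=\sum_x\max_a|v_{x,a}|$, with its standard operator space structure (the operator space $\ell_1$-direct sum of $n$ copies of the commutative $C^*$-algebra $\ell_\infty^n$). Let $H_n=\mathbb C^n$, let $R_k$ be the $k$-dimensional row operator space ($\ell_2^k$ embedded in $B(\ell_2^k)$ by $e_j\mapsto|1\rangle\langle j|$), and for $F\in\ell_1^n(\ell_\infty^n)\otimes B(H_n)$ let $\|F\|_\epsilon=\sup|(\varphi\otimes\psi)(F)|$ be the Banach space injective norm, the supremum being over functionals $\varphi\in\ell_1^n(\ell_\infty^n)^*$, $\psi\in B(H_n)^*$ of norm at most $1$, and $\|F\|_{\min}=\sup\|(u\otimes\mathrm{id})(F)\|_{B(H)\otimes_{\min}B(H_n)}$ the operator space minimal tensor norm, the supremum being over all Hilbert spaces $H$ and complete contractions $u:\ell_1^n(\ell_\infty^n)\to B(H)$. There are constants $\delta\in(0,\tfrac12)$ and $C,K,c>0$ such that for every integer $n\ge2$ there is $F\in\ell_1^n(\ell_\infty^n)\otimes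 B(H_n)$ with $\|F\|_\epsilon>0$ and $$\frac{\|F\|_{\min}}{\|F\|_\epsilon}\;\ge\; c\,\frac{\sqrt n}{\sqrt{\log n}} .$$ Moreover, whenever $k=\lfloor\delta n\rfloor\ge1$, this $F$ is of the form $F=(V\otimes W)\big(\sum_{j=1}^k e_j\otimes e_j\big)$, where $W:\ell_2^k\to B(H_n)$ is given by $W(e_j)=|1\rangle\langle j|$, and $V:\ell_2^k\to\ell_1^n(\ell_\infty^n)$ is a linear map for which there is a linear map $V':\ell_1^n(\ell_\infty^n)\to\ell_2^k$ with $V'V=\mathrm{id}$, $\|V\|\le C\sqrt{\log n}$, $\|V'\|\le1$ and $\|V':\ell_1^n(\ell_\infty^n)\to R_k\|_{cb}\le K$. -/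

import Mathlib

open scoped TensorProduct ComplexOrder

/-- The Hilbert space `ℓ₂ᵏ`. -/
abbrev L2 (k : ℕ) : Type := EuclideanSpace ℂ (Fin k)

/-- The Banach space `ℓ_∞^m`, with the sup norm. -/
abbrev LInf (m : ℕ) : Type := Fin m → ℂ

/-- The Banach space `ℓ_1^n(ℓ_∞^m)`, with norm `∑ x, max_a |v x a|`. -/
abbrev L1LInf (n m : ℕ) : Type := PiLp 1 (fun _ : Fin n => LInf m)

/-- `B(H_d)` for the `d`-dimensional Hilbert space `H_d`: the `d × d` complex matrices with the
operator (`C⋆`-algebra) norm. -/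
abbrev BFin (d : ℕ) : Type := CStarMatrix (Fin d) (Fin d) ℂ

/-! ### Operator space structures -/

/-- A family of real-valued functions on the matrix spaces `M_N(E)`, `N = 0, 1, 2, …`; the operator
space structures below are given as such families of matrix norms. -/
abbrev MatrixNorms (E : Type*) := ∀ N : ℕ, Matrix (Fin N) (Fin N) E → ℝ

/-- The canonical operator space structure of a `C⋆`-algebra `A`: the norm of `M_N(A)` is its
unique `C⋆`-norm. For `A = B(H)` this is the norm of `B(ℓ₂ᴺ(H))`; for `A = ℓ_∞^m` it is the maximum
over the `m` coordinates of the operator norm of a scalar matrix. -/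
noncomputable def cstarMatrixNorms (A : Type*) [NonUnitalCStarAlgebra A] [PartialOrder A]
    [StarOrderedRing A] : MatrixNorms A :=
  fun _ M => ‖CStarMatrix.ofMatrix M‖

/-- `‖u‖_cb ≤ K` for a linear map `u : E → G`. -/
def CBNormLE {E G : Type*} [AddCommGroup E] [Module ℂ E] [AddCommGroup G] [Module ℂ G]
    (νE : MatrixNorms E) (νG : MatrixNorms G) (u : E →ₗ[ℂ] G) (K : ℝ) : Prop :=
  ∀ (N : ℕ) (M : Matrix (Fin N) (Fin N) E), νG N (M.map u) ≤ K * νE N M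

/-- `u : E → B(H)` is a complete contraction. -/
def IsCompleteContraction {E H : Type*} [AddCommGroup E] [Module ℂ E]
    [NormedAddCommGroup H] [InnerProductSpace ℂ H] [CompleteSpace H]
    (νE : MatrixNorms E) (u : E →ₗ[ℂ] (H →L[ℂ] H)) : Prop :=
  CBNormLE νE (cstarMatrixNorms (H →L[ℂ] H)) u 1

/-- The operator space structure of the `ℓ₁`-direct sum `ℓ_1^n(E)` of `n` copies of an operator
space `E`: the norm of `M ∈ M_N(ℓ_1^n(E))` is the supremum of
`‖∑ x, (id ⊗ u_x)(M_x)‖_{M_N(B(H))}` over all Hilbert spaces `H` and all families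
`u_x : E → B(H)`, `x = 1, …, n`, of complete contractions. -/
noncomputable def l1SumMatrixNorms (n : ℕ) {E : Type*} [AddCommGroup E] [Module ℂ E]
    (νE : MatrixNorms E) : MatrixNorms (PiLp 1 (fun _ : Fin n => E)) :=
  fun N M => sSup {r : ℝ | ∃ (H : Type) (_ : NormedAddCommGroup H) (_ : InnerProductSpace ℂ H)
    (_ : CompleteSpace H) (u : Fin n → (E →ₗ[ℂ] (H →L[ℂ] H))),
    (∀ x, IsCompleteContraction νE (u x)) ∧
    r = cstarMatrixNorms (H →L[ℂ] H) N (Matrix.of fun i j => ∑ x, u x (M i j x))}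

/-- The operator space structure of `ℓ_1^n(ℓ_∞^m)`. -/
noncomputable def l1LInfMatrixNorms (n m : ℕ) : MatrixNorms (L1LInf n m) :=
  l1SumMatrixNorms n (cstarMatrixNorms (LInf m))

/-- The linear map sending the basis vector `e_j` of `ℓ₂ᵏ` to `|1⟩⟨j|`, an `n × n` matrix (when
`k ≤ n`): the first row of the value at `h` is `(h_1, …, h_k, 0, …, 0)` and the other rows
vanish. -/
noncomputable def rowMatrix (k n : ℕ) : L2 k →ₗ[ℂ] Matrix (Fin n) (Fin n) ℂ where
  toFun h := Matrix.of fun r s => ∑ j : Fin k, if r.val = 0 ∧ s.val = j.val then h j else 0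
  map_add' h h' := by
    ext r s
    simp only [Matrix.of_apply, Matrix.add_apply, ← Finset.sum_add_distrib]
    refine Finset.sum_congr rfl fun j _ => ?_
    split_ifs <;> simp
  map_smul' c h := by
    ext r s
    simp [Finset.mul_sum]

/-- The row operator space structure `R_k` on `ℓ₂ᵏ`, through `e_j ↦ |1⟩⟨j| ∈ B(ℓ₂ᵏ)`. -/
noncomputable def rowMatrixNorms (k : ℕ) : MatrixNorms (L2 k) :=
  fun N M => cstarMatrixNorms (L2 k →L[ℂ] L2 k) N
    (M.map fun h => Matrix.toEuclideanCLM (𝕜 := ℂ) (rowMatrix k k h))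

/-! ### Tensor norms -/

/-- The Banach space injective norm on `X ⊗ Y`. -/
noncomputable def injNorm {X Y : Type*} [NormedAddCommGroup X] [NormedSpace ℂ X]
    [NormedAddCommGroup Y] [NormedSpace ℂ Y] (t : X ⊗[ℂ] Y) : ℝ :=
  sSup {r : ℝ | ∃ (φ : StrongDual ℂ X) (ψ : StrongDual ℂ Y), ‖φ‖ ≤ 1 ∧ ‖ψ‖ ≤ 1 ∧
    r = ‖TensorProduct.lid ℂ ℂ (TensorProduct.map φ.toLinearMap ψ.toLinearMap t)‖}

/-- The map `u ⊗ id : E ⊗ B(H_d) → B(H) ⊗ B(H_d) = M_d(B(H))`; on elementary tensors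
`(u ⊗ id)(e ⊗ b)` is the matrix with entries `b i j • u e`. -/
noncomputable def tensorIdFin {E H : Type*} [AddCommGroup E] [Module ℂ E]
    [NormedAddCommGroup H] [InnerProductSpace ℂ H] [CompleteSpace H] (d : ℕ)
    (u : E →ₗ[ℂ] (H →L[ℂ] H)) (t : E ⊗[ℂ] BFin d) :
    CStarMatrix (Fin d) (Fin d) (H →L[ℂ] H) :=
  CStarMatrix.ofMatrix ((matrixEquivTensor (Fin d) ℂ (H →L[ℂ] H)).symm
    (TensorProduct.map u (CStarMatrix.ofMatrixₗ (R := ℂ)).symm.toLinearMap t))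

/-- The operator space minimal tensor norm on `E ⊗ B(H_d)`: the supremum of
`‖(u ⊗ id)(t)‖_{B(H) ⊗_min B(H_d)}` over all Hilbert spaces `H` and all complete contractions
`u : E → B(H)`, where `B(H) ⊗_min B(H_d) = M_d(B(H))`. -/
noncomputable def minNorm {E : Type*} [AddCommGroup E] [Module ℂ E] (νE : MatrixNorms E) {d : ℕ}
    (t : E ⊗[ℂ] BFin d) : ℝ :=
  sSup {r : ℝ | ∃ (H : Type) (_ : NormedAddCommGroup H) (_ : InnerProductSpace ℂ H)
    (_ : CompleteSpace H) (u : E →ₗ[ℂ] (H →L[ℂ] H)),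
    IsCompleteContraction νE u ∧ r = ‖tensorIdFin d u t‖}

/-- The map `W : ℓ₂ᵏ → B(H_n)`, `W(e_j) = |1⟩⟨j|` (for `k ≤ n`). -/
noncomputable def rowMap (k n : ℕ) : L2 k →ₗ[ℂ] BFin n :=
  (CStarMatrix.ofMatrixₗ (R := ℂ)).toLinearMap ∘ₗ rowMatrix k n

/-! The tensor `F` is the image of `∑ e_j ⊗ e_j`, and the gap comes from a copy of `ℓ₂ᵏ` in
`ℓ_1^n(ℓ_∞^n)` that is `√log n`-complemented and carries a row structure under its projection. For
each `x` take the first `k` rows of the Fourier matrix and multiply row `j` by a sign `s j x`; `V`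
(`frameSynthesis`) evaluates `h` against the resulting vectors, and `V'` (`frameAnalysis`) is its
adjoint. Orthogonality of the rows makes each `x` contribute `n⁻¹ • id` to `V'V`, whatever the signs
are.

Lower bound on the minimal norm: on each summand `ℓ_∞^n`, `V'` followed by the row embedding has the
form `f ↦ S diag(f) T` with contractions `S`, `T`, so `V'` is completely contractive into `R_k`
(`cbNormLE_frameAnalysis`). Applying it to `F` gives `∑ |1⟩⟨j| ⊗ |1⟩⟨j|`, of norm at least `√k`
(`sqrt_le_minNorm_entangled`).

Upper bound on the injective norm: it is at most `‖V‖ ‖W‖ ≤ ‖V‖`. Bounding `‖V‖` means controlling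
`∑ x` of one selected coordinate `a x` in each block, for all selections and all outer signs `e`.
For random `s` every such choice has a subgaussian tail, and a union bound over the `n^n 2^n`
choices costs only a factor `√log n` (`exists_signs_sum_norm_sq_le`, `norm_frameSynthesis_le`). -/

/-! ### Random signs: exponential moments and the union bound -/

/-- The sign `±1` coded by a Boolean. -/
def boolSign (b : Bool) : ℂ := if b then 1 else -1

@[simp] lemma norm_boolSign (b : Bool) : ‖boolSign b‖ = 1 := by cases b <;> simp [boolSign]

@[simp] lemma conj_boolSign (b : Bool) : (starRingEnd ℂ) (boolSign b) = boolSign b := by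
  cases b <;> simp [boolSign]

@[simp] lemma boolSign_mul_self (b : Bool) : boolSign b * boolSign b = 1 := by
  cases b <;> simp [boolSign]

/-- Expanding the square isolates the cross term `±2tr` with `r = Re⟨z, w⟩`; summing over the sign
turns it into a `cosh`, and `cosh y ≤ exp (y²/2)` absorbs it into the coefficient of `‖z‖ ^ 2`. This
is the one-sign step of an induction in which `t` is replaced by `t (1 + 2t)`. -/
lemma sum_bool_exp_norm_sq_le (z w : ℂ) (hw : ‖w‖ ≤ 1) {t : ℝ} (ht : 0 ≤ t) :
    ∑ b : Bool, Real.exp (t * ‖z + boolSign b * w‖ ^ 2) ≤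
      2 * Real.exp (t + t * (1 + 2 * t) * ‖z‖ ^ 2) := by
  set r : ℝ := inner ℝ z w with hr
  have hadd : ‖z + w‖ ^ 2 = ‖z‖ ^ 2 + 2 * r + ‖w‖ ^ 2 := norm_add_sq_real z w
  have hsub : ‖z - w‖ ^ 2 = ‖z‖ ^ 2 - 2 * r + ‖w‖ ^ 2 := norm_sub_sq_real z w
  have hr2 : r ^ 2 ≤ ‖z‖ ^ 2 := by
    have h := abs_real_inner_le_norm z w
    rw [← sq_abs r]
    gcongr
    exact h.trans (mul_le_of_le_one_right (norm_nonneg z) hw)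
  have hcosh := Real.cosh_le_exp_half_sq (2 * t * r)
  have hsum : ∑ b : Bool, Real.exp (t * ‖z + boolSign b * w‖ ^ 2) =
      2 * (Real.exp (t * (‖z‖ ^ 2 + ‖w‖ ^ 2)) * Real.cosh (2 * t * r)) := by
    simp only [Fintype.sum_bool, boolSign, if_true, one_mul, Bool.false_eq_true, if_false, neg_mul,
      ← sub_eq_add_neg]
    rw [hadd, hsub, Real.cosh_eq]
    have h1 : t * (‖z‖ ^ 2 + 2 * r + ‖w‖ ^ 2) = t * (‖z‖ ^ 2 + ‖w‖ ^ 2) + 2 * t * r := by ring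
    have h2 : t * (‖z‖ ^ 2 - 2 * r + ‖w‖ ^ 2) = t * (‖z‖ ^ 2 + ‖w‖ ^ 2) + -(2 * t * r) := by ring
    rw [h1, h2, Real.exp_add, Real.exp_add]
    ring
  rw [hsum]
  refine mul_le_mul_of_nonneg_left ?_ zero_le_two
  calc _ ≤ Real.exp (t * (‖z‖ ^ 2 + ‖w‖ ^ 2)) * Real.exp ((2 * t * r) ^ 2 / 2) := by gcongr
    _ = Real.exp (t * (‖z‖ ^ 2 + ‖w‖ ^ 2) + (2 * t * r) ^ 2 / 2) := (Real.exp_add _ _).symm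
    _ ≤ _ := by
      apply Real.exp_le_exp.2
      have hw2 : ‖w‖ ^ 2 ≤ 1 := pow_le_one₀ (norm_nonneg w) hw
      have h1 : t * ‖w‖ ^ 2 ≤ t := mul_le_of_le_one_right ht hw2
      have h2 : t ^ 2 * r ^ 2 ≤ t ^ 2 * ‖z‖ ^ 2 := by gcongr
      nlinarith

/-- An exponential square moment of a Rademacher sum with coefficients of modulus at most one. -/
lemma sum_signs_exp_norm_sq_le {t : ℝ} (ht : 0 ≤ t) (m : ℕ) (htm : 4 * t * m < 1)
    (w : Fin m → ℂ) (hw : ∀ x, ‖w x‖ ≤ 1) (z : ℂ) :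
    ∑ s : Fin m → Bool, Real.exp (t * ‖z + ∑ x, boolSign (s x) * w x‖ ^ 2) ≤
      2 ^ m * Real.exp (t / (1 - 4 * t * m) * (‖z‖ ^ 2 + m)) := by
  induction m generalizing z with
  | zero => simp
  | succ m ih =>
    push_cast at htm ⊢
    have htm' : 4 * t * m < 1 := by nlinarith
    -- For `t > 0`, `1/q = 1/p - 4`, so `q = p / (1 - 4p)` dominates the coefficient `p (1 + 2p)`
    -- produced by summing over one more sign.
    set p : ℝ := t / (1 - 4 * t * m) with hp
    set q : ℝ := t / (1 - 4 * t * (m + 1)) with hq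
    have hd : 0 < 1 - 4 * t * m := by linarith
    have hd' : 0 < 1 - 4 * t * (m + 1) := by linarith
    have hp0 : 0 ≤ p := div_nonneg ht hd.le
    have hq0 : 0 ≤ q := div_nonneg ht hd'.le
    have hpq : p * (1 + 2 * p) ≤ q := by
      have hpt : p * (1 - 4 * t * m) = t := div_mul_cancel₀ _ hd.ne'
      rw [hq, le_div_iff₀ hd']
      nlinarith [mul_nonneg hp0 hp0, mul_nonneg hp0 ht, mul_nonneg (mul_nonneg hp0 hp0) ht]
    have hpq' : p ≤ q := by nlinarith
    rw [← (Fin.consEquiv (fun _ : Fin (m + 1) => Bool)).sum_comp, Fintype.sum_prod_type]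
    calc _ = ∑ b : Bool, ∑ s : Fin m → Bool, Real.exp (t * ‖(z + boolSign b * w 0) +
            ∑ x, boolSign (s x) * w x.succ‖ ^ 2) := by
          simp [Fin.consEquiv, Fin.sum_univ_succ, add_assoc]
      _ ≤ ∑ b : Bool, 2 ^ m * Real.exp (p * (‖z + boolSign b * w 0‖ ^ 2 + m)) :=
          Finset.sum_le_sum fun b _ => ih htm' (fun x => w x.succ) (fun x => hw _) _
      _ = 2 ^ m * Real.exp (p * m) * ∑ b : Bool, Real.exp (p * ‖z + boolSign b * w 0‖ ^ 2) := by
          rw [Finset.mul_sum]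
          refine Finset.sum_congr rfl fun b _ => ?_
          rw [mul_assoc, ← Real.exp_add]
          ring_nf
      _ ≤ 2 ^ m * Real.exp (p * m) * (2 * Real.exp (p + p * (1 + 2 * p) * ‖z‖ ^ 2)) := by
          gcongr
          exact sum_bool_exp_norm_sq_le z (w 0) (hw 0) hp0
      _ = 2 ^ (m + 1) * Real.exp (p * m + (p + p * (1 + 2 * p) * ‖z‖ ^ 2)) := by
          rw [Real.exp_add (p * m)]
          ring
      _ ≤ _ := by
          gcongr
          have h1 : p * (1 + 2 * p) * ‖z‖ ^ 2 ≤ q * ‖z‖ ^ 2 := by gcongr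
          have h2 : p * (m + 1) ≤ q * (m + 1) := by gcongr
          linarith

/-- There are signs for which all the selections from `n` sign-modulated copies of a bounded matrix
have small row sums in mean square. -/
lemma exists_signs_sum_norm_sq_le {n k : ℕ} (hn : 2 ≤ n) (hk : k ≤ n) (w : Fin k → Fin n → ℂ)
    (hw : ∀ j a, ‖w j a‖ ≤ 1) :
    ∃ s : Fin k → Fin n → Bool, ∀ (a : Fin n → Fin n) (e : Fin n → Bool),
      ∑ j, ‖∑ x, boolSign (s j x) * (boolSign (e x) * w j (a x))‖ ^ 2 ≤
        32 * (n : ℝ) ^ 2 * Real.log n := by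
  by_contra! hcon
  have hn0 : (0 : ℝ) < n := by positivity
  set Q : (Fin k → Fin n → Bool) → (Fin n → Fin n) → (Fin n → Bool) → ℝ := fun s a e =>
    ∑ j, ‖∑ x, boolSign (s j x) * (boolSign (e x) * w j (a x))‖ ^ 2 with hQ
  -- With this `t`, `4 * t * n = 1/2`, so each row `j` contributes at most `exp (1/4)` on average,
  -- while a failure of the bound gives `t * Q > 4 n log n`.
  set t : ℝ := 1 / (8 * n) with ht
  have ht0 : 0 < t := by positivity
  have hexp (a : Fin n → Fin n) (e : Fin n → Bool) :
      ∑ s, Real.exp (t * Q s a e) ≤ (2 ^ n * Real.exp (1 / 4)) ^ k := by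
    calc _ = ∑ s : Fin k → Fin n → Bool, ∏ j, Real.exp (t *
            ‖∑ x, boolSign (s j x) * (boolSign (e x) * w j (a x))‖ ^ 2) := by
          simp only [hQ, Finset.mul_sum, Real.exp_sum]
      -- The rows `s j` of the sign array are independent.
      _ = ∏ j, ∑ s : Fin n → Bool, Real.exp (t *
            ‖∑ x, boolSign (s x) * (boolSign (e x) * w j (a x))‖ ^ 2) := by
          rw [Finset.prod_univ_sum, Fintype.piFinset_univ]
      _ ≤ ∏ _j : Fin k, (2 ^ n * Real.exp (1 / 4)) := by
          refine Finset.prod_le_prod (fun _ _ => by positivity) fun j _ => ?_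
          have h := sum_signs_exp_norm_sq_le ht0.le n (by rw [ht]; field_simp; norm_num)
            (fun x => boolSign (e x) * w j (a x)) (fun x => by simpa using hw j (a x)) 0
          have hval : t / (1 - 4 * t * n) * (‖(0 : ℂ)‖ ^ 2 + n) = 1 / 4 := by
            rw [ht]; field_simp; norm_num; ring
          rw [hval] at h
          simpa using h
      _ = _ := by simp
  have hlow (s : Fin k → Fin n → Bool) :
      Real.exp (4 * n * Real.log n) ≤ ∑ a, ∑ e, Real.exp (t * Q s a e) := by
    obtain ⟨a, e, h⟩ := hcon s
    have h1 : Real.exp (4 * n * Real.log n) ≤ Real.exp (t * Q s a e) := by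
      apply Real.exp_le_exp.2
      calc 4 * n * Real.log n = t * (32 * (n : ℝ) ^ 2 * Real.log n) := by
            rw [ht]; field_simp; ring
        _ ≤ _ := by gcongr
    refine h1.trans ?_
    refine (Finset.single_le_sum (f := fun e => Real.exp (t * Q s a e))
      (fun _ _ => by positivity) (Finset.mem_univ e)).trans ?_
    exact Finset.single_le_sum (f := fun a => ∑ e, Real.exp (t * Q s a e))
      (fun _ _ => by positivity) (Finset.mem_univ a)
  have hL : 0 < Real.log n := Real.log_pos (by exact_mod_cast hn)
  have hL2 : (1 : ℝ) / 2 ≤ Real.log n := by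
    have h2 : Real.log 2 ≤ Real.log n := Real.log_le_log (by norm_num) (by exact_mod_cast hn)
    linarith [Real.log_two_gt_d9]
  have htot : (2 ^ n) ^ k * Real.exp (4 * n * Real.log n) ≤
      (2 ^ n) ^ k * (((n : ℝ) ^ n * 2 ^ n) * Real.exp (1 / 4) ^ k) := by
    calc _ = ∑ _s : Fin k → Fin n → Bool, Real.exp (4 * n * Real.log n) := by simp
      _ ≤ ∑ s, ∑ a, ∑ e, Real.exp (t * Q s a e) := Finset.sum_le_sum fun s _ => hlow s
      _ = ∑ a, ∑ e, ∑ s, Real.exp (t * Q s a e) := by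
          rw [Finset.sum_comm]
          exact Finset.sum_congr rfl fun a _ => Finset.sum_comm
      _ ≤ ∑ _a : Fin n → Fin n, ∑ _e : Fin n → Bool, (2 ^ n * Real.exp (1 / 4)) ^ k :=
          Finset.sum_le_sum fun a _ => Finset.sum_le_sum fun e _ => hexp a e
      _ = _ := by
          simp only [Finset.sum_const, Finset.card_univ, nsmul_eq_mul, Fintype.card_pi_const,
            Fintype.card_fin, Fintype.card_bool]
          push_cast
          ring
  -- Each of the three factors is at most `exp (n log n)`: the second since `2 ≤ n`, the third since
  -- `k ≤ n` and `log n ≥ 1/2`. The total `3 n log n` stays below `4 n log n`.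
  have hlt : ((n : ℝ) ^ n * 2 ^ n) * Real.exp (1 / 4) ^ k < Real.exp (4 * n * Real.log n) := by
    have h1 : (n : ℝ) ^ n = Real.exp (n * Real.log n) := by
      rw [Real.exp_nat_mul, Real.exp_log hn0]
    have h2 : (2 : ℝ) ^ n ≤ Real.exp (n * Real.log n) := by
      rw [← h1]
      gcongr
      exact_mod_cast hn
    have h3 : Real.exp (1 / 4) ^ k ≤ Real.exp (n * Real.log n) := by
      rw [← Real.exp_nat_mul]
      apply Real.exp_le_exp.2
      have : (k : ℝ) ≤ n := by exact_mod_cast hk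
      nlinarith
    calc _ ≤ Real.exp (n * Real.log n) * Real.exp (n * Real.log n) * Real.exp (n * Real.log n) := by
          rw [h1]; gcongr
      _ = Real.exp (3 * (n * Real.log n)) := by rw [← Real.exp_add, ← Real.exp_add]; ring_nf
      _ < _ := by
          apply Real.exp_lt_exp.2
          nlinarith [mul_pos hn0 hL]
  exact absurd (le_of_mul_le_mul_left htot (by positivity)) (not_le.2 hlt)

/-- Choosing `e x` as the sign of the `x`-th real part removes the absolute values; Cauchy–Schwarz
in `j` then applies to the single vector `∑ x, ± v x`. -/
lemma sum_abs_re_le_of_signs {n k : ℕ} {B : ℝ} (v : Fin n → Fin k → ℂ)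
    (hv : ∀ e : Fin n → Bool, ∑ j, ‖∑ x, boolSign (e x) * v x j‖ ^ 2 ≤ B ^ 2) (hB : 0 ≤ B)
    (h : L2 k) : ∑ x, |(∑ j, v x j * h j).re| ≤ B * ‖h‖ := by
  set e : Fin n → Bool := fun x => decide (0 ≤ (∑ j, v x j * h j).re) with he
  have h1 : ∑ x, |(∑ j, v x j * h j).re| = (∑ j, (∑ x, boolSign (e x) * v x j) * h j).re := by
    have : ∑ j, (∑ x, boolSign (e x) * v x j) * h j =
        ∑ x, boolSign (e x) * ∑ j, v x j * h j := by
      simp only [Finset.sum_mul, Finset.mul_sum]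
      rw [Finset.sum_comm]
      simp only [mul_assoc]
    rw [this, Complex.re_sum]
    refine Finset.sum_congr rfl fun x _ => ?_
    by_cases hx : 0 ≤ (∑ j, v x j * h j).re
    · simp only [he, hx, boolSign, decide_true, if_true, one_mul, abs_of_nonneg hx]
    · simp only [he, hx, boolSign, decide_false, Bool.false_eq_true, if_false, neg_mul, one_mul,
        Complex.neg_re, abs_of_neg (not_le.1 hx)]
  rw [h1]
  calc _ ≤ ‖∑ j, (∑ x, boolSign (e x) * v x j) * h j‖ := Complex.re_le_norm _
    _ ≤ ∑ j, ‖∑ x, boolSign (e x) * v x j‖ * ‖h j‖ :=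
        (norm_sum_le _ _).trans (by simp only [norm_mul, le_refl])
    _ ≤ √(∑ j, ‖∑ x, boolSign (e x) * v x j‖ ^ 2) * √(∑ j, ‖h j‖ ^ 2) :=
        Real.sum_mul_le_sqrt_mul_sqrt _ _ _
    _ ≤ B * ‖h‖ := by
        rw [EuclideanSpace.norm_eq h]
        gcongr
        exact Real.sqrt_le_iff.2 ⟨hB, hv e⟩

/-- Real signs only see real parts; applying the real bound to `h` and to `i h` covers the imaginary
parts, hence the factor `2`. -/
lemma sum_norm_le_of_signs {n k : ℕ} {B : ℝ} (v : Fin n → Fin k → ℂ)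
    (hv : ∀ e : Fin n → Bool, ∑ j, ‖∑ x, boolSign (e x) * v x j‖ ^ 2 ≤ B ^ 2) (hB : 0 ≤ B)
    (h : L2 k) : ∑ x, ‖∑ j, v x j * h j‖ ≤ 2 * B * ‖h‖ := by
  have h1 := sum_abs_re_le_of_signs v hv hB h
  have h2 := sum_abs_re_le_of_signs v hv hB (Complex.I • h)
  rw [norm_smul, Complex.norm_I, one_mul] at h2
  have h3 (x : Fin n) : |(∑ j, v x j * (Complex.I • h) j).re| = |(∑ j, v x j * h j).im| := by
    have : ∑ j, v x j * (Complex.I • h) j = Complex.I * ∑ j, v x j * h j := by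
      rw [Finset.mul_sum]
      refine Finset.sum_congr rfl fun j _ => ?_
      rw [PiLp.smul_apply, smul_eq_mul]
      ring
    rw [this, Complex.I_mul_re, abs_neg]
  simp only [h3] at h2
  calc _ ≤ ∑ x, (|(∑ j, v x j * h j).re| + |(∑ j, v x j * h j).im|) :=
        Finset.sum_le_sum fun x _ => Complex.norm_le_abs_re_add_abs_im _
    _ ≤ _ := by rw [Finset.sum_add_distrib]; linarith

/-! ### Orthogonality of the Fourier matrix -/

/-- The `n`-th roots of unity `exp(2πi j a / n)`. -/
noncomputable def dftEntry (n j a : ℕ) : ℂ := Complex.exp (2 * Real.pi * Complex.I / n) ^ (j * a)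

lemma norm_dftEntry (n j a : ℕ) : ‖dftEntry n j a‖ = 1 := by
  have : 2 * (Real.pi : ℂ) * Complex.I / n = ((2 * Real.pi / n : ℝ) : ℂ) * Complex.I := by
    push_cast; ring
  rw [dftEntry, norm_pow, this, Complex.norm_exp_ofReal_mul_I, one_pow]

lemma sum_conj_dftEntry_mul {n : ℕ} (i j : Fin n) :
    ∑ a : Fin n, (starRingEnd ℂ) (dftEntry n i a) * dftEntry n j a = if i = j then (n : ℂ) else 0 := by
  have hn : n ≠ 0 := (i.pos).ne'
  split_ifs with hij
  · subst hij
    simp [Complex.conj_mul', norm_dftEntry]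
  · set ω : ℂ := Complex.exp (2 * Real.pi * Complex.I / n) with hω
    have hprim : IsPrimitiveRoot ω n := Complex.isPrimitiveRoot_exp n hn
    have hnorm : ‖ω‖ = 1 := by simpa [dftEntry] using norm_dftEntry n 1 1
    have hconj : (starRingEnd ℂ) ω * ω = 1 := by simp [Complex.conj_mul', hnorm]
    set q : ℂ := (starRingEnd ℂ) ω ^ (i : ℕ) * ω ^ (j : ℕ) with hq
    have hqn : q ^ n = 1 := by
      rw [hq, mul_pow, ← pow_mul, ← pow_mul, mul_comm (i : ℕ), mul_comm (j : ℕ), pow_mul, pow_mul,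
        ← map_pow, hprim.pow_eq_one]
      simp
    have hq1 : q ≠ 1 := by
      intro h
      apply hij
      have : ω ^ (j : ℕ) = ω ^ (i : ℕ) := by
        calc _ = ω ^ (i : ℕ) * q := by
              rw [hq, ← mul_assoc, ← mul_pow, mul_comm ω, hconj, one_pow, one_mul]
          _ = _ := by rw [h, mul_one]
      exact Fin.ext (hprim.pow_inj i.2 j.2 this.symm)
    have hsum : ∑ a : Fin n, (starRingEnd ℂ) (dftEntry n i a) * dftEntry n j a =
        ∑ a ∈ Finset.range n, q ^ a := by
      rw [← Fin.sum_univ_eq_sum_range]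
      refine Finset.sum_congr rfl fun a _ => ?_
      rw [hq, dftEntry, dftEntry, mul_pow, map_pow, pow_mul, pow_mul]
    rw [hsum]
    have := geom_sum_mul q n
    rw [hqn, sub_self] at this
    exact (mul_eq_zero.1 this).resolve_right (sub_ne_zero.2 hq1)

/-! ### Matrices of operators and complete contractions -/

section OperatorMatrix

variable {G H : Type*} [NormedAddCommGroup G] [InnerProductSpace ℂ G]
  [NormedAddCommGroup H] [InnerProductSpace ℂ H]

/-- The operator on the `ℓ₂`-sum of `N` copies of `H` given by an `N × N` matrix of operators. -/
noncomputable def operatorOfMatrix {N : ℕ} (M : Matrix (Fin N) (Fin N) (H →L[ℂ] H)) :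
    PiLp 2 (fun _ : Fin N => H) →L[ℂ] PiLp 2 (fun _ : Fin N => H) :=
  (PiLp.continuousLinearEquiv 2 ℂ (fun _ : Fin N => H)).symm.toContinuousLinearMap ∘L
    ContinuousLinearMap.pi fun i => ∑ j, M i j ∘L PiLp.proj 2 (fun _ : Fin N => H) j

lemma operatorOfMatrix_apply {N : ℕ} (M : Matrix (Fin N) (Fin N) (H →L[ℂ] H))
    (v : PiLp 2 (fun _ : Fin N => H)) (i : Fin N) :
    operatorOfMatrix M v i = ∑ j, M i j (v j) := by
  simp [operatorOfMatrix]

/-- The representation of `M_N(B(H))` on the `ℓ₂`-sum of `N` copies of `H`. -/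
noncomputable def operatorOfMatrixHom (N : ℕ) (H : Type*) [NormedAddCommGroup H]
    [InnerProductSpace ℂ H] [CompleteSpace H] :
    CStarMatrix (Fin N) (Fin N) (H →L[ℂ] H) →⋆ₙₐ[ℂ]
      (PiLp 2 (fun _ : Fin N => H) →L[ℂ] PiLp 2 (fun _ : Fin N => H)) where
  toFun M := operatorOfMatrix (CStarMatrix.ofMatrix.symm M)
  map_smul' c M := by
    ext v i
    simp [operatorOfMatrix_apply, Finset.smul_sum]
  map_zero' := by
    ext v i
    simp [operatorOfMatrix_apply]
  map_add' M M' := by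
    ext v i
    simp [operatorOfMatrix_apply, Finset.sum_add_distrib]
  map_mul' M M' := by
    ext v i
    simp only [operatorOfMatrix_apply, CStarMatrix.ofMatrix_symm_apply, CStarMatrix.mul_apply,
      mul_apply_eq_comp, sum_apply, map_sum]
    exact Finset.sum_comm
  map_star' M := by
    rw [ContinuousLinearMap.star_eq_adjoint, ContinuousLinearMap.eq_adjoint_iff]
    intro v w
    simp only [PiLp.inner_apply, operatorOfMatrix_apply, CStarMatrix.ofMatrix_symm_apply,
      CStarMatrix.star_apply, ContinuousLinearMap.star_eq_adjoint, sum_inner, inner_sum,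
      ContinuousLinearMap.adjoint_inner_left]
    exact Finset.sum_comm

/-- An injective `⋆`-homomorphism of `C⋆`-algebras is isometric; injectivity follows by reading off
entries on vectors supported in one coordinate. This makes the abstract `C⋆`-norm computable on
vectors. -/
lemma norm_operatorOfMatrix [CompleteSpace H] {N : ℕ} (M : Matrix (Fin N) (Fin N) (H →L[ℂ] H)) :
    ‖operatorOfMatrix M‖ = ‖CStarMatrix.ofMatrix M‖ := by
  refine NonUnitalStarAlgHom.norm_map (operatorOfMatrixHom N H) ?_ (CStarMatrix.ofMatrix M)
  intro A B hAB
  refine CStarMatrix.ext fun i j => ContinuousLinearMap.ext fun h => ?_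
  have h1 : operatorOfMatrixHom N H A (PiLp.single 2 j h) i =
      operatorOfMatrixHom N H B (PiLp.single 2 j h) i := by rw [hAB]
  have key (C : CStarMatrix (Fin N) (Fin N) (H →L[ℂ] H)) :
      operatorOfMatrixHom N H C (PiLp.single 2 j h) i = C i j h := by
    refine (operatorOfMatrix_apply _ _ _).trans ?_
    rw [Finset.sum_eq_single j]
    · simp
    · intro b _ hb
      simp [hb]
    · simp
  rwa [key, key] at h1

lemma norm_operatorOfMatrix_apply_le [CompleteSpace H] {N : ℕ} (M : Matrix (Fin N) (Fin N) (H →L[ℂ] H))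
    (v : PiLp 2 (fun _ : Fin N => H)) :
    ‖operatorOfMatrix M v‖ ≤ ‖CStarMatrix.ofMatrix M‖ * ‖v‖ := by
  rw [← norm_operatorOfMatrix]
  exact ContinuousLinearMap.le_opNorm _ _

lemma norm_piLp_map_le {N : ℕ} (S : G →L[ℂ] H) (hS : ‖S‖ ≤ 1) (v : PiLp 2 (fun _ : Fin N => G)) :
    ‖(WithLp.toLp 2 fun i => S (v i) : PiLp 2 (fun _ : Fin N => H))‖ ≤ ‖v‖ := by
  rw [PiLp.norm_eq_of_L2, PiLp.norm_eq_of_L2]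
  gcongr with i
  simpa using S.le_of_opNorm_le hS (v i)

lemma norm_ofMatrix_comp_le [CompleteSpace G] [CompleteSpace H] {N : ℕ} (S : G →L[ℂ] H)
    (T : H →L[ℂ] G) (hS : ‖S‖ ≤ 1) (hT : ‖T‖ ≤ 1)
    (M : Matrix (Fin N) (Fin N) (G →L[ℂ] G)) :
    ‖CStarMatrix.ofMatrix (M.map fun A => S ∘L A ∘L T)‖ ≤ ‖CStarMatrix.ofMatrix M‖ := by
  rw [← norm_operatorOfMatrix]
  refine ContinuousLinearMap.opNorm_le_bound _ (norm_nonneg _) fun v => ?_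
  set w : PiLp 2 (fun _ : Fin N => G) := WithLp.toLp 2 fun i => T (v i) with hw
  have h1 : operatorOfMatrix (M.map fun A => S ∘L A ∘L T) v =
      WithLp.toLp 2 fun i => S (operatorOfMatrix M w i) := by
    ext i
    simp [operatorOfMatrix_apply, hw]
  rw [h1]
  calc _ ≤ ‖operatorOfMatrix M w‖ := norm_piLp_map_le S hS _
    _ ≤ ‖CStarMatrix.ofMatrix M‖ * ‖w‖ := norm_operatorOfMatrix_apply_le M w
    _ ≤ _ := by gcongr; exact norm_piLp_map_le T hT v

end OperatorMatrix

/-- The representation of `ℓ_∞^m` on `ℓ₂^m` by diagonal operators. -/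
noncomputable def diagonalHom (m : ℕ) : LInf m →⋆ₙₐ[ℂ] (L2 m →L[ℂ] L2 m) where
  toFun f := Matrix.toEuclideanCLM (𝕜 := ℂ) (Matrix.diagonal f)
  map_smul' c f := by rw [Matrix.diagonal_smul, map_smul]; rfl
  map_zero' := by simp
  map_add' f g := by rw [← map_add, Matrix.diagonal_add]; rfl
  map_mul' f g := by rw [← map_mul, Matrix.diagonal_mul_diagonal]; rfl
  map_star' f := by rw [← map_star, Matrix.star_eq_conjTranspose, Matrix.diagonal_conjTranspose]

lemma diagonalHom_apply {m : ℕ} (f : LInf m) (v : L2 m) (a : Fin m) :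
    diagonalHom m f v a = f a * v a := by
  change (Matrix.toEuclideanCLM (𝕜 := ℂ) (Matrix.diagonal f) v).ofLp a = _
  rw [Matrix.ofLp_toEuclideanCLM, Matrix.mulVec_diagonal]

/-- The easy direction of the Stinespring–Wittstock factorization: a `⋆`-homomorphism is completely
contractive, and so is compression by contractions on either side. -/
lemma isCompleteContraction_comp_diagonalHom {m : ℕ} {H : Type*} [NormedAddCommGroup H]
    [InnerProductSpace ℂ H] [CompleteSpace H] (u : LInf m →ₗ[ℂ] (H →L[ℂ] H)) (S : L2 m →L[ℂ] H)
    (T : H →L[ℂ] L2 m) (hS : ‖S‖ ≤ 1) (hT : ‖T‖ ≤ 1) (hu : ∀ f, u f = S ∘L diagonalHom m f ∘L T) :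
    IsCompleteContraction (cstarMatrixNorms (LInf m)) u := by
  intro N M
  rw [one_mul]
  have h1 : M.map u = (M.map (diagonalHom m)).map fun A => S ∘L A ∘L T := by
    ext1 i j
    simp [hu]
  have h2 := NonUnitalStarAlgHom.norm_apply_le (CStarMatrix.mapₙₐ (n := Fin N) (diagonalHom m))
    (CStarMatrix.ofMatrix M)
  calc _ = ‖CStarMatrix.ofMatrix ((M.map (diagonalHom m)).map fun A => S ∘L A ∘L T)‖ := by
        rw [← h1]; rfl
    _ ≤ ‖CStarMatrix.ofMatrix (M.map (diagonalHom m))‖ := norm_ofMatrix_comp_le S T hS hT _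
    _ ≤ _ := h2

/-- A real `sSup` of an unbounded set is `0`, so bounding it below by a member requires boundedness;
here the triangle inequality over the `n` summands suffices. -/
lemma bddAbove_l1SumMatrixNorms {n : ℕ} {E : Type*} [AddCommGroup E] [Module ℂ E]
    (νE : MatrixNorms E) {N : ℕ} (M : Matrix (Fin N) (Fin N) (PiLp 1 (fun _ : Fin n => E))) :
    BddAbove {r : ℝ | ∃ (H : Type) (_ : NormedAddCommGroup H) (_ : InnerProductSpace ℂ H)
      (_ : CompleteSpace H) (u : Fin n → (E →ₗ[ℂ] (H →L[ℂ] H))),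
      (∀ x, IsCompleteContraction νE (u x)) ∧
      r = cstarMatrixNorms (H →L[ℂ] H) N (Matrix.of fun i j => ∑ x, u x (M i j x))} := by
  refine ⟨∑ x, νE N (M.map fun f => f x), ?_⟩
  rintro r ⟨H, _, _, _, u, hu, rfl⟩
  have h1 : CStarMatrix.ofMatrix (Matrix.of fun i j => ∑ x, u x (M i j x)) =
      ∑ x, CStarMatrix.ofMatrix ((M.map fun f => f x).map (u x)) := by
    rw [CStarMatrix.ofMatrix_eq_ofMatrixL, ← map_sum]
    congr 1
    ext1 i j
    simp [Matrix.sum_apply]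
  unfold cstarMatrixNorms
  rw [h1]
  refine (norm_sum_le _ _).trans (Finset.sum_le_sum fun x _ => ?_)
  simpa [cstarMatrixNorms] using hu x N (M.map fun f => f x)

lemma cstarMatrixNorms_le_l1SumMatrixNorms {n : ℕ} {E : Type*} [AddCommGroup E] [Module ℂ E]
    (νE : MatrixNorms E) {N : ℕ} (M : Matrix (Fin N) (Fin N) (PiLp 1 (fun _ : Fin n => E)))
    {H : Type} [NormedAddCommGroup H] [InnerProductSpace ℂ H] [CompleteSpace H]
    (u : Fin n → (E →ₗ[ℂ] (H →L[ℂ] H))) (hu : ∀ x, IsCompleteContraction νE (u x)) :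
    cstarMatrixNorms (H →L[ℂ] H) N (Matrix.of fun i j => ∑ x, u x (M i j x)) ≤
      l1SumMatrixNorms n νE N M :=
  le_csSup (bddAbove_l1SumMatrixNorms νE M) ⟨H, _, _, _, u, hu, rfl⟩

/-! ### Finiteness of the minimal tensor norm -/

section MinNorm

variable {E : Type*} [AddCommGroup E] [Module ℂ E] {d : ℕ}

lemma tensorIdFin_tmul_apply {H : Type*} [NormedAddCommGroup H] [InnerProductSpace ℂ H]
    [CompleteSpace H] (u : E →ₗ[ℂ] (H →L[ℂ] H)) (e : E) (b : BFin d) (i j : Fin d) :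
    tensorIdFin d u (e ⊗ₜ[ℂ] b) i j = b i j • u e := by
  have : tensorIdFin d u (e ⊗ₜ[ℂ] b) i j = u e * algebraMap ℂ (H →L[ℂ] H) (b i j) := by
    simp only [tensorIdFin, TensorProduct.map_tmul, matrixEquivTensor_apply_symm]
    rfl
  rw [this, Algebra.algebraMap_eq_smul_one, mul_smul_comm, mul_one]

lemma tensorIdFin_add {H : Type*} [NormedAddCommGroup H] [InnerProductSpace ℂ H]
    [CompleteSpace H] (u : E →ₗ[ℂ] (H →L[ℂ] H)) (t t' : E ⊗[ℂ] BFin d) :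
    tensorIdFin d u (t + t') = tensorIdFin d u t + tensorIdFin d u t' := by
  simp only [tensorIdFin, map_add]
  rfl

lemma norm_le_of_isCompleteContraction {νE : MatrixNorms E} {H : Type*} [NormedAddCommGroup H]
    [InnerProductSpace ℂ H] [CompleteSpace H] {u : E →ₗ[ℂ] (H →L[ℂ] H)}
    (hu : IsCompleteContraction νE u) (e : E) : ‖u e‖ ≤ νE 1 (Matrix.of fun _ _ => e) := by
  have h := hu 1 (Matrix.of fun _ _ => e)
  rw [one_mul] at h
  exact (CStarMatrix.norm_entry_le_norm (M := CStarMatrix.ofMatrix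
    ((Matrix.of fun _ _ => e : Matrix (Fin 1) (Fin 1) E).map u)) (i := 0) (j := 0)).trans h

lemma norm_cstarMatrix_le_sum {H : Type*} [NormedAddCommGroup H] [InnerProductSpace ℂ H]
    [CompleteSpace H] (M : Matrix (Fin d) (Fin d) (H →L[ℂ] H)) :
    ‖CStarMatrix.ofMatrix M‖ ≤ ∑ i, ∑ j, ‖M i j‖ := by
  rw [← norm_operatorOfMatrix]
  refine ContinuousLinearMap.opNorm_le_bound _ (by positivity) fun v => ?_
  have h1 : operatorOfMatrix M v = ∑ i, PiLp.single 2 i (∑ j, M i j (v j)) := by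
    ext i
    rw [operatorOfMatrix_apply]
    simp [Pi.single_apply]
  rw [h1, Finset.sum_mul]
  refine (norm_sum_le _ _).trans (Finset.sum_le_sum fun i _ => ?_)
  rw [PiLp.norm_single, Finset.sum_mul]
  refine (norm_sum_le _ _).trans (Finset.sum_le_sum fun j _ => ?_)
  exact ContinuousLinearMap.le_opNorm_of_le _ (PiLp.norm_apply_le v j)

lemma bddAbove_minNorm (νE : MatrixNorms E) (t : E ⊗[ℂ] BFin d) :
    BddAbove {r : ℝ | ∃ (H : Type) (_ : NormedAddCommGroup H) (_ : InnerProductSpace ℂ H)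
      (_ : CompleteSpace H) (u : E →ₗ[ℂ] (H →L[ℂ] H)),
      IsCompleteContraction νE u ∧ r = ‖tensorIdFin d u t‖} := by
  suffices h : ∃ B : ℝ, ∀ (H : Type) (_ : NormedAddCommGroup H) (_ : InnerProductSpace ℂ H)
      (_ : CompleteSpace H) (u : E →ₗ[ℂ] (H →L[ℂ] H)),
      IsCompleteContraction νE u → ‖tensorIdFin d u t‖ ≤ B by
    obtain ⟨B, hB⟩ := h
    refine ⟨B, ?_⟩
    rintro r ⟨H, _, _, _, u, hu, rfl⟩
    exact hB H _ _ _ u hu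
  induction t with
  | zero =>
    refine ⟨0, fun H _ _ _ u _ => ?_⟩
    have : tensorIdFin d u (0 : E ⊗[ℂ] BFin d) = 0 := by
      simp only [tensorIdFin, map_zero]
      rfl
    rw [this, norm_zero]
  | tmul e b =>
    refine ⟨∑ i, ∑ j, ‖b i j‖ * νE 1 (Matrix.of fun _ _ => e), fun H _ _ _ u hu => ?_⟩
    refine (norm_cstarMatrix_le_sum (CStarMatrix.ofMatrix.symm (tensorIdFin d u (e ⊗ₜ b)))).trans ?_
    gcongr with i _ j _
    rw [CStarMatrix.ofMatrix_symm_apply, tensorIdFin_tmul_apply, norm_smul]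
    gcongr
    exact norm_le_of_isCompleteContraction hu e
  | add t t' ht ht' =>
    obtain ⟨B, hB⟩ := ht
    obtain ⟨B', hB'⟩ := ht'
    refine ⟨B + B', fun H _ _ _ u hu => ?_⟩
    rw [tensorIdFin_add]
    exact (norm_add_le _ _).trans (add_le_add (hB H _ _ _ u hu) (hB' H _ _ _ u hu))

lemma norm_tensorIdFin_le_minNorm (νE : MatrixNorms E) (t : E ⊗[ℂ] BFin d) {H : Type}
    [NormedAddCommGroup H] [InnerProductSpace ℂ H] [CompleteSpace H] (u : E →ₗ[ℂ] (H →L[ℂ] H))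
    (hu : IsCompleteContraction νE u) : ‖tensorIdFin d u t‖ ≤ minNorm νE t :=
  le_csSup (bddAbove_minNorm νE t) ⟨H, _, _, _, u, hu, rfl⟩

end MinNorm

/-! ### Row matrices -/

lemma rowMatrix_mulVec {k n : ℕ} (hk : k ≤ n) (h : L2 k) (v : Fin n → ℂ) (r : Fin n) :
    (rowMatrix k n h).mulVec v r =
      if r.val = 0 then ∑ j, h j * v (Fin.castLE hk j) else 0 := by
  simp only [Matrix.mulVec, dotProduct, rowMatrix, LinearMap.coe_mk, AddHom.coe_mk, Matrix.of_apply]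
  split_ifs with hr
  · simp only [hr, true_and, Finset.sum_mul]
    rw [Finset.sum_comm]
    refine Finset.sum_congr rfl fun j _ => ?_
    rw [Finset.sum_eq_single (Fin.castLE hk j)]
    · simp
    · intro s _ hs
      rw [if_neg, zero_mul]
      exact fun h' => hs (Fin.ext h')
    · simp
  · simp [hr]

lemma rowMatrix_single_apply {k n : ℕ} (j : Fin k) (r s : Fin n) :
    rowMatrix k n (EuclideanSpace.single j 1) r s =
      if r.val = 0 ∧ s.val = j.val then 1 else 0 := by
  simp only [rowMatrix, LinearMap.coe_mk, AddHom.coe_mk, Matrix.of_apply]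
  rw [Finset.sum_eq_single j]
  · simp
  · intro i _ hi
    simp [hi]
  · simp

lemma norm_rowMap_le {k n : ℕ} (hk : k ≤ n) (h : L2 k) : ‖rowMap k n h‖ ≤ ‖h‖ := by
  have h1 : ‖Matrix.toEuclideanCLM (𝕜 := ℂ) (rowMatrix k n h)‖ = ‖rowMap k n h‖ :=
    NonUnitalStarAlgHom.norm_map ((CStarMatrix.ofMatrixStarAlgEquiv (n := Fin n) (A := ℂ)).symm.trans
      (Matrix.toEuclideanCLM (n := Fin n) (𝕜 := ℂ))) (EquivLike.injective _) (rowMap k n h)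
  rw [← h1]
  refine ContinuousLinearMap.opNorm_le_bound _ (norm_nonneg _) fun v => ?_
  have hsum : ‖∑ j, h j * v (Fin.castLE hk j)‖ ≤ ‖h‖ * ‖v‖ := by
    calc _ ≤ ∑ j, ‖h j‖ * ‖v (Fin.castLE hk j)‖ :=
          (norm_sum_le _ _).trans (by simp only [norm_mul, le_refl])
      _ ≤ √(∑ j, ‖h j‖ ^ 2) * √(∑ j, ‖v (Fin.castLE hk j)‖ ^ 2) :=
          Real.sum_mul_le_sqrt_mul_sqrt _ _ _
      _ ≤ _ := by
          rw [EuclideanSpace.norm_eq h, EuclideanSpace.norm_eq v]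
          gcongr
          have := Finset.sum_map Finset.univ (Fin.castLEEmb hk) fun s => ‖v s‖ ^ 2
          rw [Fin.coe_castLEEmb] at this
          rw [← this]
          exact Finset.sum_le_univ_sum_of_nonneg fun s => by positivity
  refine le_trans ?_ hsum
  set c := ∑ j, h j * v (Fin.castLE hk j) with hc
  have hap (r : Fin n) : Matrix.toEuclideanCLM (𝕜 := ℂ) (rowMatrix k n h) v r =
      if r.val = 0 then c else 0 := by
    rw [Matrix.ofLp_toEuclideanCLM, rowMatrix_mulVec hk]
  rcases Nat.eq_zero_or_pos n with rfl | hn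
  · simp [EuclideanSpace.norm_eq]
  · have : Matrix.toEuclideanCLM (𝕜 := ℂ) (rowMatrix k n h) v =
        EuclideanSpace.single (⟨0, hn⟩ : Fin n) c := by
      ext r
      rw [hap]
      simp [Fin.ext_iff]
    rw [this, PiLp.norm_single]

/-- The embedding of the row space `R_k` into `B(ℓ₂ᵏ)`. -/
noncomputable def rowOperator (k : ℕ) : L2 k →ₗ[ℂ] (L2 k →L[ℂ] L2 k) :=
  (Matrix.toEuclideanCLM (n := Fin k) (𝕜 := ℂ)).toAlgEquiv.toLinearMap ∘ₗ rowMatrix k k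

lemma rowOperator_apply {k : ℕ} (hk : 0 < k) (h v : L2 k) :
    rowOperator k h v = EuclideanSpace.single (⟨0, hk⟩ : Fin k) (∑ j, h j * v j) := by
  ext r
  change (Matrix.toEuclideanCLM (𝕜 := ℂ) (rowMatrix k k h) v).ofLp r = _
  rw [Matrix.ofLp_toEuclideanCLM, rowMatrix_mulVec le_rfl]
  simp [Fin.ext_iff]

/-- Tested on the conjugate vector of `h`, the row operator attains `‖h‖ ^ 2`. -/
lemma norm_le_norm_rowOperator {k : ℕ} (hk : 0 < k) (h : L2 k) : ‖h‖ ≤ ‖rowOperator k h‖ := by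
  set g : L2 k := WithLp.toLp 2 fun j => (starRingEnd ℂ) (h j) with hg
  have hgn : ‖g‖ = ‖h‖ := by simp [EuclideanSpace.norm_eq, hg]
  have h1 : ‖rowOperator k h g‖ = ‖h‖ ^ 2 := by
    have : ∑ j, h j * g j = ((‖h‖ ^ 2 : ℝ) : ℂ) := by
      rw [EuclideanSpace.norm_sq_eq]
      push_cast
      simp only [hg, Complex.mul_conj']
    rw [rowOperator_apply hk, PiLp.norm_single, this, Complex.norm_real, Real.norm_eq_abs,
      abs_of_nonneg (by positivity)]
  have h2 := (rowOperator k h).le_opNorm g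
  rw [h1, hgn, sq] at h2
  rcases (norm_nonneg h).eq_or_lt with h0 | h0
  · rw [← h0]
    exact norm_nonneg _
  · exact le_of_mul_le_mul_right h2 h0

/-! ### Analysis and synthesis maps of the sign-modulated Fourier bases -/

section Frame

variable {n k : ℕ}

/-- The `j`-th coordinate of the `a`-th vector of the `x`-th sign-modulated Fourier basis. -/
noncomputable def frameCoeff (s : Fin k → Fin n → Bool) (x a : Fin n) (j : Fin k) : ℂ :=
  boolSign (s j x) * dftEntry n j a

/-- The signs do not depend on `a`, so they factor out of the sum and square to `1` on the diagonal:
sign modulation preserves orthogonality. -/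
lemma sum_conj_frameCoeff_mul (hk : k ≤ n) (s : Fin k → Fin n → Bool) (x : Fin n) (i j : Fin k) :
    ∑ a, (starRingEnd ℂ) (frameCoeff s x a i) * frameCoeff s x a j =
      if i = j then (n : ℂ) else 0 := by
  have h := sum_conj_dftEntry_mul (Fin.castLE hk i) (Fin.castLE hk j)
  simp only [Fin.val_castLE, (Fin.castLE_injective hk).eq_iff] at h
  calc _ = boolSign (s i x) * boolSign (s j x) *
        ∑ a : Fin n, (starRingEnd ℂ) (dftEntry n i a) * dftEntry n j a := by
        rw [Finset.mul_sum]
        refine Finset.sum_congr rfl fun a _ => ?_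
        rw [frameCoeff, frameCoeff, map_mul, conj_boolSign]
        ring
    _ = _ := by
        rw [h]
        split_ifs with hij
        · rw [hij, boolSign_mul_self, one_mul]
        · rw [mul_zero]

set_option synthInstance.maxHeartbeats 200000 in
/-- The synthesis map `ℓ₂ᵏ → ℓ_1^n(ℓ_∞^n)`. -/
noncomputable def frameSynthesis (s : Fin k → Fin n → Bool) : L2 k →L[ℂ] L1LInf n n :=
  LinearMap.toContinuousLinearMap
    { toFun := fun h => WithLp.toLp 1 fun x a => (n : ℂ)⁻¹ * ∑ j, frameCoeff s x a j * h j
      map_add' := fun h h' => by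
        ext x a
        simp [mul_add, Finset.sum_add_distrib]
      map_smul' := fun c h => by
        ext x a
        simp only [PiLp.smul_apply, Pi.smul_apply, smul_eq_mul, RingHom.id_apply, Finset.mul_sum]
        exact Finset.sum_congr rfl fun j _ => by ring }

lemma frameSynthesis_apply (s : Fin k → Fin n → Bool) (h : L2 k) (x a : Fin n) :
    frameSynthesis s h x a = (n : ℂ)⁻¹ * ∑ j, frameCoeff s x a j * h j := rfl

/-- The analysis map `ℓ_∞^n → ℓ₂ᵏ` of the `x`-th basis. -/
noncomputable def basisAnalysis (s : Fin k → Fin n → Bool) (x : Fin n) : LInf n →ₗ[ℂ] L2 k where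
  toFun f := WithLp.toLp 2 fun j => (n : ℂ)⁻¹ * ∑ a, (starRingEnd ℂ) (frameCoeff s x a j) * f a
  map_add' f g := by
    ext j
    simp [mul_add, Finset.sum_add_distrib]
  map_smul' c f := by
    ext j
    simp only [PiLp.smul_apply, Pi.smul_apply, smul_eq_mul, RingHom.id_apply, Finset.mul_sum]
    exact Finset.sum_congr rfl fun j _ => by ring

lemma basisAnalysis_apply (s : Fin k → Fin n → Bool) (x : Fin n) (f : LInf n) (j : Fin k) :
    basisAnalysis s x f j = (n : ℂ)⁻¹ * ∑ a, (starRingEnd ℂ) (frameCoeff s x a j) * f a := rfl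

set_option synthInstance.maxHeartbeats 200000 in
/-- The analysis map `ℓ_1^n(ℓ_∞^n) → ℓ₂ᵏ`. -/
noncomputable def frameAnalysis (s : Fin k → Fin n → Bool) : L1LInf n n →L[ℂ] L2 k :=
  LinearMap.toContinuousLinearMap
    { toFun := fun f => ∑ x, basisAnalysis s x (f x)
      map_add' := fun f g => by simp [Finset.sum_add_distrib]
      map_smul' := fun c f => by simp [Finset.smul_sum] }

lemma frameAnalysis_apply (s : Fin k → Fin n → Bool) (f : L1LInf n n) :
    frameAnalysis s f = ∑ x, basisAnalysis s x (f x) := rfl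

lemma frameAnalysis_comp_frameSynthesis (hn : 0 < n) (hk : k ≤ n) (s : Fin k → Fin n → Bool) :
    frameAnalysis s ∘L frameSynthesis s = ContinuousLinearMap.id ℂ (L2 k) := by
  have hn0 : (n : ℂ) ≠ 0 := by exact_mod_cast hn.ne'
  have hx (x : Fin n) (h : L2 k) :
      basisAnalysis s x (frameSynthesis s h x) = (n : ℂ)⁻¹ • h := by
    ext i
    rw [basisAnalysis_apply, PiLp.smul_apply, smul_eq_mul]
    congr 1
    calc _ = (n : ℂ)⁻¹ * ∑ j, (∑ a, (starRingEnd ℂ) (frameCoeff s x a i) * frameCoeff s x a j) *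
            h j := by
          simp only [frameSynthesis_apply, Finset.mul_sum, Finset.sum_mul]
          rw [Finset.sum_comm]
          exact Finset.sum_congr rfl fun j _ => Finset.sum_congr rfl fun a _ => by ring
      _ = h i := by
          simp only [sum_conj_frameCoeff_mul hk, ite_mul, zero_mul, Finset.sum_ite_eq,
            Finset.mem_univ, if_true]
          rw [inv_mul_cancel_left₀ hn0]
  ext1 h
  rw [ContinuousLinearMap.comp_apply, frameAnalysis_apply]
  simp only [hx, Finset.sum_const, Finset.card_univ, Fintype.card_fin, ContinuousLinearMap.id_apply]
  rw [← Nat.cast_smul_eq_nsmul ℂ, smul_smul, mul_inv_cancel₀ hn0, one_smul]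

/-- The isometry `ℓ₂ᵏ → ℓ₂ⁿ` with the conjugate entries of the `x`-th basis. -/
noncomputable def basisIsometry (s : Fin k → Fin n → Bool) (x : Fin n) : L2 k →L[ℂ] L2 n :=
  LinearMap.toContinuousLinearMap
    { toFun := fun h => WithLp.toLp 2 fun a =>
        ((√n : ℝ) : ℂ)⁻¹ * ∑ j, (starRingEnd ℂ) (frameCoeff s x a j) * h j
      map_add' := fun h h' => by
        ext a
        simp [mul_add, Finset.sum_add_distrib]
      map_smul' := fun c h => by
        ext a
        simp only [PiLp.smul_apply, smul_eq_mul, RingHom.id_apply, Finset.mul_sum]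
        exact Finset.sum_congr rfl fun j _ => by ring }

lemma basisIsometry_apply (s : Fin k → Fin n → Bool) (x a : Fin n) (h : L2 k) :
    basisIsometry s x h a =
      ((√n : ℝ) : ℂ)⁻¹ * ∑ j, (starRingEnd ℂ) (frameCoeff s x a j) * h j := rfl

lemma ofReal_sqrt_mul_self (n : ℕ) : ((√n : ℝ) : ℂ) * ((√n : ℝ) : ℂ) = n := by
  rw [← Complex.ofReal_mul, Real.mul_self_sqrt (Nat.cast_nonneg n), Complex.ofReal_natCast]

lemma norm_basisIsometry_apply (hn : 0 < n) (hk : k ≤ n) (s : Fin k → Fin n → Bool) (x : Fin n)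
    (h : L2 k) : ‖basisIsometry s x h‖ = ‖h‖ := by
  have hn0 : (n : ℂ) ≠ 0 := by exact_mod_cast hn.ne'
  have hsq : ‖basisIsometry s x h‖ ^ 2 = ‖h‖ ^ 2 := by
    rw [EuclideanSpace.norm_sq_eq, EuclideanSpace.norm_sq_eq]
    apply Complex.ofReal_injective
    push_cast
    simp only [← Complex.mul_conj', basisIsometry_apply]
    have hc : (((√n : ℝ) : ℂ)⁻¹) * ((√n : ℝ) : ℂ)⁻¹ = (n : ℂ)⁻¹ := by
      rw [← mul_inv, ofReal_sqrt_mul_self]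
    calc _ = ∑ a, ∑ i, ∑ j, (n : ℂ)⁻¹ * ((starRingEnd ℂ) (frameCoeff s x a i) *
            frameCoeff s x a j * (h i * (starRingEnd ℂ) (h j))) := by
          refine Finset.sum_congr rfl fun a _ => ?_
          rw [map_mul, mul_mul_mul_comm, map_inv₀, Complex.conj_ofReal, hc, map_sum,
            Finset.sum_mul_sum, Finset.mul_sum]
          refine Finset.sum_congr rfl fun i _ => ?_
          rw [Finset.mul_sum]
          refine Finset.sum_congr rfl fun j _ => ?_
          rw [map_mul, Complex.conj_conj]
          ring
      _ = (n : ℂ)⁻¹ * ∑ i, ∑ j, (∑ a, (starRingEnd ℂ) (frameCoeff s x a i) *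
            frameCoeff s x a j) * (h i * (starRingEnd ℂ) (h j)) := by
          rw [Finset.sum_comm, Finset.mul_sum]
          refine Finset.sum_congr rfl fun i _ => ?_
          rw [Finset.sum_comm, Finset.mul_sum]
          refine Finset.sum_congr rfl fun j _ => ?_
          rw [Finset.sum_mul, Finset.mul_sum]
      _ = _ := by
          simp only [sum_conj_frameCoeff_mul hk, ite_mul, zero_mul, Finset.sum_ite_eq,
            Finset.mem_univ, if_true, ← Finset.mul_sum]
          rw [inv_mul_cancel_left₀ hn0]
  exact (sq_eq_sq₀ (norm_nonneg _) (norm_nonneg _)).1 hsq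

/-- Splitting `n⁻¹` as `(√n)⁻¹ (√n)⁻¹` normalizes both sides at once: one factor makes
`basisIsometry` isometric, the other makes the constant vector a unit vector. This factorization is
what yields complete contractivity. -/
lemma rowOperator_basisAnalysis (hk0 : 0 < k) (s : Fin k → Fin n → Bool) (x : Fin n) (f : LInf n) :
    rowOperator k (basisAnalysis s x f) =
      ((innerSL ℂ (WithLp.toLp 2 fun _ => ((√n : ℝ) : ℂ)⁻¹ : L2 n)).smulRight
        (EuclideanSpace.single (⟨0, hk0⟩ : Fin k) (1 : ℂ))) ∘L diagonalHom n f ∘L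
        basisIsometry s x := by
  ext1 v
  rw [rowOperator_apply hk0]
  simp only [ContinuousLinearMap.comp_apply, ContinuousLinearMap.smulRight_apply, innerSL_apply_apply,
    PiLp.inner_apply, RCLike.inner_apply, diagonalHom_apply, basisIsometry_apply, map_inv₀,
    Complex.conj_ofReal, basisAnalysis_apply]
  have hc : (((√n : ℝ) : ℂ)⁻¹) * ((√n : ℝ) : ℂ)⁻¹ = (n : ℂ)⁻¹ := by
    rw [← mul_inv, ofReal_sqrt_mul_self]
  ext r
  simp only [PiLp.smul_apply, smul_eq_mul, PiLp.single_apply, mul_ite, mul_one, mul_zero]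
  congr 1
  simp only [← hc, Finset.mul_sum, Finset.sum_mul]
  rw [Finset.sum_comm]
  exact Finset.sum_congr rfl fun j _ => Finset.sum_congr rfl fun a _ => by ring

lemma norm_rowFunctional_le (hn : 0 < n) (hk0 : 0 < k) :
    ‖((innerSL ℂ (WithLp.toLp 2 fun _ => ((√n : ℝ) : ℂ)⁻¹ : L2 n)).smulRight
        (EuclideanSpace.single (⟨0, hk0⟩ : Fin k) (1 : ℂ)) : L2 n →L[ℂ] L2 k)‖ ≤ 1 := by
  rw [ContinuousLinearMap.norm_smulRight_apply, innerSL_apply_norm, PiLp.norm_single,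
    norm_one, mul_one, EuclideanSpace.norm_eq]
  have hn0 : (n : ℝ) ≠ 0 := by exact_mod_cast hn.ne'
  simp [hn0]

lemma norm_basisIsometry_le (hn : 0 < n) (hk : k ≤ n) (s : Fin k → Fin n → Bool) (x : Fin n) :
    ‖basisIsometry s x‖ ≤ 1 :=
  ContinuousLinearMap.opNorm_le_bound _ zero_le_one fun h => by
    rw [norm_basisIsometry_apply hn hk, one_mul]

lemma isCompleteContraction_basisAnalysis (hn : 0 < n) (hk0 : 0 < k) (hk : k ≤ n)
    (s : Fin k → Fin n → Bool) (x : Fin n) :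
    IsCompleteContraction (cstarMatrixNorms (LInf n)) (rowOperator k ∘ₗ basisAnalysis s x) :=
  isCompleteContraction_comp_diagonalHom _ _ _ (norm_rowFunctional_le hn hk0)
    (norm_basisIsometry_le hn hk s x) fun f => rowOperator_basisAnalysis hk0 s x f

lemma norm_basisAnalysis_le (hn : 0 < n) (hk0 : 0 < k) (hk : k ≤ n) (s : Fin k → Fin n → Bool)
    (x : Fin n) (f : LInf n) : ‖basisAnalysis s x f‖ ≤ ‖f‖ := by
  refine (norm_le_norm_rowOperator hk0 _).trans ?_
  rw [rowOperator_basisAnalysis hk0]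
  refine (ContinuousLinearMap.opNorm_comp_le _ _).trans ?_
  refine (mul_le_of_le_one_left (norm_nonneg _) (norm_rowFunctional_le hn hk0)).trans ?_
  refine (ContinuousLinearMap.opNorm_comp_le _ _).trans ?_
  refine (mul_le_of_le_one_right (norm_nonneg _) (norm_basisIsometry_le hn hk s x)).trans ?_
  exact NonUnitalStarAlgHom.norm_apply_le (diagonalHom n) f

lemma norm_frameAnalysis_le (hn : 0 < n) (hk0 : 0 < k) (hk : k ≤ n) (s : Fin k → Fin n → Bool) :
    ‖frameAnalysis s‖ ≤ 1 := by
  refine ContinuousLinearMap.opNorm_le_bound _ zero_le_one fun f => ?_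
  rw [one_mul, frameAnalysis_apply, PiLp.norm_eq_of_L1]
  exact (norm_sum_le _ _).trans
    (Finset.sum_le_sum fun x _ => norm_basisAnalysis_le hn hk0 hk s x (f x))

lemma cbNormLE_frameAnalysis (hn : 0 < n) (hk0 : 0 < k) (hk : k ≤ n) (s : Fin k → Fin n → Bool) :
    CBNormLE (l1LInfMatrixNorms n n) (rowMatrixNorms k) (frameAnalysis s).toLinearMap 1 := by
  intro N M
  rw [one_mul]
  refine le_of_eq_of_le ?_ (cstarMatrixNorms_le_l1SumMatrixNorms (cstarMatrixNorms (LInf n)) M _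
    fun x => isCompleteContraction_basisAnalysis hn hk0 hk s x)
  unfold rowMatrixNorms
  congr 1
  ext1 i j
  change rowOperator k (frameAnalysis s (M i j)) = _
  simp [frameAnalysis_apply]

lemma isCompleteContraction_frameAnalysis (hn : 0 < n) (hk0 : 0 < k) (hk : k ≤ n)
    (s : Fin k → Fin n → Bool) :
    IsCompleteContraction (l1LInfMatrixNorms n n) (rowOperator k ∘ₗ (frameAnalysis s).toLinearMap) :=
  fun N M => cbNormLE_frameAnalysis hn hk0 hk s N M

lemma norm_frameSynthesis_le (hn : 0 < n) (s : Fin k → Fin n → Bool) {B : ℝ} (hB : 0 ≤ B)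
    (hs : ∀ (a : Fin n → Fin n) (e : Fin n → Bool),
      ∑ j, ‖∑ x, boolSign (s j x) * (boolSign (e x) * dftEntry n j (a x))‖ ^ 2 ≤ B ^ 2) :
    ‖frameSynthesis s‖ ≤ 2 * B / n := by
  refine ContinuousLinearMap.opNorm_le_bound _ (by positivity) fun h => ?_
  have : Nonempty (Fin n) := ⟨⟨0, hn⟩⟩
  -- Selecting a maximizing coordinate in each block reduces the mixed norm to one selection `a`.
  -- The selection depends on `h`, which is why the sign bound has to hold for all selections.
  have hmax (x : Fin n) : ∃ a, ∀ b, ‖frameSynthesis s h x b‖ ≤ ‖frameSynthesis s h x a‖ :=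
    Finite.exists_max fun b => ‖frameSynthesis s h x b‖
  choose a ha using hmax
  rw [PiLp.norm_eq_of_L1]
  calc _ ≤ ∑ x, ‖frameSynthesis s h x (a x)‖ :=
        Finset.sum_le_sum fun x _ => (pi_norm_le_iff_of_nonneg (norm_nonneg _)).2 (ha x)
    _ = (n : ℝ)⁻¹ * ∑ x, ‖∑ j, frameCoeff s x (a x) j * h j‖ := by
        rw [Finset.mul_sum]
        refine Finset.sum_congr rfl fun x _ => ?_
        rw [frameSynthesis_apply, norm_mul, norm_inv, Complex.norm_natCast]
    _ ≤ (n : ℝ)⁻¹ * (2 * B * ‖h‖) := by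
        gcongr
        refine sum_norm_le_of_signs (fun x j => frameCoeff s x (a x) j) (fun e => ?_) hB h
        refine le_of_eq_of_le ?_ (hs a e)
        simp only [frameCoeff, mul_left_comm]
    _ = _ := by ring

end Frame

/-! ### Tensor norms of the image of the maximally entangled tensor -/

section Tensor

variable {k : ℕ} {X Y : Type*} [NormedAddCommGroup X] [NormedSpace ℂ X] [NormedAddCommGroup Y]
  [NormedSpace ℂ Y]

lemma linearMap_apply_eq_sum_single {Z : Type*} [AddCommGroup Z] [Module ℂ Z] (A : L2 k →ₗ[ℂ] Z)
    (h : L2 k) : A h = ∑ j, h j • A (EuclideanSpace.single j 1) := by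
  conv_lhs => rw [← (EuclideanSpace.basisFun (Fin k) ℂ).sum_repr h]
  simp

lemma lid_map_entangled (φ : StrongDual ℂ X) (ψ : StrongDual ℂ Y) (V : L2 k →L[ℂ] X)
    (W : L2 k →ₗ[ℂ] Y) :
    TensorProduct.lid ℂ ℂ (TensorProduct.map φ.toLinearMap ψ.toLinearMap
      (TensorProduct.map V.toLinearMap W (∑ j : Fin k,
        EuclideanSpace.single j (1 : ℂ) ⊗ₜ[ℂ] EuclideanSpace.single j (1 : ℂ)))) =
      ∑ j, φ (V (EuclideanSpace.single j 1)) * ψ (W (EuclideanSpace.single j 1)) := by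
  simp [map_sum]

/-- The pairing equals `φ (V g)`, where `g` lists the coefficients of `ψ ∘ W`; self-duality of `ℓ₂ᵏ`
gives `‖g‖ ≤ 1`. -/
lemma norm_lid_map_entangled_le (φ : StrongDual ℂ X) (ψ : StrongDual ℂ Y) (hφ : ‖φ‖ ≤ 1)
    (hψ : ‖ψ‖ ≤ 1) (V : L2 k →L[ℂ] X) (W : L2 k →ₗ[ℂ] Y) (hW : ∀ h, ‖W h‖ ≤ ‖h‖) :
    ‖TensorProduct.lid ℂ ℂ (TensorProduct.map φ.toLinearMap ψ.toLinearMap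
      (TensorProduct.map V.toLinearMap W (∑ j : Fin k,
        EuclideanSpace.single j (1 : ℂ) ⊗ₜ[ℂ] EuclideanSpace.single j (1 : ℂ))))‖ ≤ ‖V‖ := by
  rw [lid_map_entangled]
  set g : L2 k := WithLp.toLp 2 fun j => ψ (W (EuclideanSpace.single j 1)) with hg
  set g' : L2 k := WithLp.toLp 2 fun j => (starRingEnd ℂ) (g j) with hg'
  have hgn : ‖g'‖ = ‖g‖ := by simp [EuclideanSpace.norm_eq, hg']
  have hg1 : ‖g‖ ≤ 1 := by
    have h1 : ψ (W g') = ((‖g‖ ^ 2 : ℝ) : ℂ) := by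
      rw [linearMap_apply_eq_sum_single W g', map_sum, EuclideanSpace.norm_sq_eq]
      push_cast
      refine Finset.sum_congr rfl fun j _ => ?_
      rw [map_smul, smul_eq_mul, ← Complex.conj_mul']
    have h2 : ‖g‖ ^ 2 ≤ ‖g‖ := by
      calc ‖g‖ ^ 2 = ‖ψ (W g')‖ := by
            rw [h1, Complex.norm_real, Real.norm_eq_abs, abs_of_nonneg (by positivity)]
        _ ≤ ‖W g'‖ := by simpa using ψ.le_of_opNorm_le hψ (W g')
        _ ≤ ‖g‖ := (hW g').trans_eq hgn
    by_contra! hlt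
    nlinarith
  have h3 : ∑ j, φ (V (EuclideanSpace.single j 1)) * ψ (W (EuclideanSpace.single j 1)) =
      φ (V g) := by
    have := linearMap_apply_eq_sum_single V.toLinearMap g
    rw [ContinuousLinearMap.coe_coe] at this
    rw [this, map_sum]
    refine Finset.sum_congr rfl fun j _ => ?_
    rw [map_smul, smul_eq_mul, mul_comm]
  rw [h3]
  calc _ ≤ ‖V g‖ := by simpa using φ.le_of_opNorm_le hφ (V g)
    _ ≤ ‖V‖ * ‖g‖ := V.le_opNorm g
    _ ≤ ‖V‖ := mul_le_of_le_one_right (norm_nonneg _) hg1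

lemma injNorm_entangled_le (V : L2 k →L[ℂ] X) (W : L2 k →ₗ[ℂ] Y) (hW : ∀ h, ‖W h‖ ≤ ‖h‖) :
    injNorm (TensorProduct.map V.toLinearMap W (∑ j : Fin k,
        EuclideanSpace.single j (1 : ℂ) ⊗ₜ[ℂ] EuclideanSpace.single j (1 : ℂ))) ≤ ‖V‖ := by
  refine Real.sSup_le ?_ (norm_nonneg _)
  rintro r ⟨φ, ψ, hφ, hψ, rfl⟩
  exact norm_lid_map_entangled_le φ ψ hφ hψ V W hW

lemma le_injNorm_entangled (V : L2 k →L[ℂ] X) (W : L2 k →ₗ[ℂ] Y) (hW : ∀ h, ‖W h‖ ≤ ‖h‖)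
    (φ : StrongDual ℂ X) (ψ : StrongDual ℂ Y) (hφ : ‖φ‖ ≤ 1) (hψ : ‖ψ‖ ≤ 1) :
    ‖∑ j, φ (V (EuclideanSpace.single j 1)) * ψ (W (EuclideanSpace.single j 1))‖ ≤
      injNorm (TensorProduct.map V.toLinearMap W (∑ j : Fin k,
        EuclideanSpace.single j (1 : ℂ) ⊗ₜ[ℂ] EuclideanSpace.single j (1 : ℂ))) := by
  rw [← lid_map_entangled]
  refine le_csSup ⟨‖V‖, ?_⟩ ⟨φ, ψ, hφ, hψ, rfl⟩
  rintro r ⟨φ, ψ, hφ, hψ, rfl⟩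
  exact norm_lid_map_entangled_le φ ψ hφ hψ V W hW

/-- The first coordinate of `V'` paired with the top-left matrix entry detects only the term `j =
0`. The bound supplies the positivity needed to divide by the injective norm. -/
lemma one_le_injNorm_entangled {n : ℕ} (hk0 : 0 < k) (hk : k ≤ n) (V : L2 k →L[ℂ] X)
    (V' : X →L[ℂ] L2 k) (hV' : ‖V'‖ ≤ 1) (hid : V' ∘L V = ContinuousLinearMap.id ℂ (L2 k)) :
    1 ≤ injNorm (TensorProduct.map V.toLinearMap (rowMap k n) (∑ j : Fin k,
        EuclideanSpace.single j (1 : ℂ) ⊗ₜ[ℂ] EuclideanSpace.single j (1 : ℂ))) := by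
  have hn : 0 < n := hk0.trans_le hk
  let ψ₀ : BFin n →ₗ[ℂ] ℂ :=
    { toFun := fun M => M ⟨0, hn⟩ ⟨0, hn⟩
      map_add' := fun _ _ => rfl
      map_smul' := fun _ _ => rfl }
  let ψ : StrongDual ℂ (BFin n) := ψ₀.mkContinuous 1 fun M => by
    rw [one_mul]
    exact CStarMatrix.norm_entry_le_norm (M := M) (i := ⟨0, hn⟩) (j := ⟨0, hn⟩)
  have hψ : ‖ψ‖ ≤ 1 := LinearMap.mkContinuous_norm_le _ zero_le_one _
  let φ : StrongDual ℂ X := innerSL ℂ (EuclideanSpace.single (⟨0, hk0⟩ : Fin k) (1 : ℂ)) ∘L V'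
  have hφ : ‖φ‖ ≤ 1 := by
    refine (ContinuousLinearMap.opNorm_comp_le _ _).trans ?_
    rw [innerSL_apply_norm, PiLp.norm_single, norm_one, one_mul]
    exact hV'
  refine le_of_eq_of_le ?_ (le_injNorm_entangled V (rowMap k n) (norm_rowMap_le hk) φ ψ hφ hψ)
  have hφV (h : L2 k) : φ (V h) = h ⟨0, hk0⟩ := by
    have : V' (V h) = h := by
      rw [← ContinuousLinearMap.comp_apply, hid, ContinuousLinearMap.id_apply]
    simp only [φ, ContinuousLinearMap.comp_apply, this, innerSL_apply_apply]
    simp [EuclideanSpace.inner_single_left]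
  have hψW (j : Fin k) : ψ (rowMap k n (EuclideanSpace.single j 1)) =
      if j.val = 0 then 1 else 0 := by
    change rowMatrix k n (EuclideanSpace.single j 1) ⟨0, hn⟩ ⟨0, hn⟩ = _
    rw [rowMatrix_single_apply]
    simp [eq_comm]
  simp only [hφV, hψW]
  rw [Finset.sum_eq_single (⟨0, hk0⟩ : Fin k)]
  · simp
  · intro j _ hj
    have : j.val ≠ 0 := fun h => hj (Fin.ext h)
    simp [this]
  · simp

lemma tensorIdFin_sum {E H ι : Type*} [AddCommGroup E] [Module ℂ E] [NormedAddCommGroup H]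
    [InnerProductSpace ℂ H] [CompleteSpace H] {d : ℕ} (u : E →ₗ[ℂ] (H →L[ℂ] H)) (S : Finset ι)
    (t : ι → E ⊗[ℂ] BFin d) (r c : Fin d) :
    tensorIdFin d u (∑ i ∈ S, t i) r c = ∑ i ∈ S, tensorIdFin d u (t i) r c := by
  classical
  induction S using Finset.induction_on with
  | empty =>
    simp only [Finset.sum_empty, tensorIdFin, map_zero]
    rfl
  | insert i S hi ih =>
    rw [Finset.sum_insert hi, Finset.sum_insert hi, tensorIdFin_add, CStarMatrix.add_apply, ih]

lemma sqrt_le_minNorm_entangled {n : ℕ} (hk0 : 0 < k) (hk : k ≤ n) (νX : MatrixNorms X)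
    (V : L2 k →L[ℂ] X) (V' : X →L[ℂ] L2 k) (hid : V' ∘L V = ContinuousLinearMap.id ℂ (L2 k))
    (hV' : IsCompleteContraction νX (rowOperator k ∘ₗ V'.toLinearMap)) :
    √k ≤ minNorm νX (TensorProduct.map V.toLinearMap (rowMap k n) (∑ j : Fin k,
        EuclideanSpace.single j (1 : ℂ) ⊗ₜ[ℂ] EuclideanSpace.single j (1 : ℂ))) := by
  have hn : 0 < n := hk0.trans_le hk
  refine le_trans ?_ (norm_tensorIdFin_le_minNorm νX _ _ hV')
  set A := tensorIdFin n (rowOperator k ∘ₗ V'.toLinearMap)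
    (TensorProduct.map V.toLinearMap (rowMap k n) (∑ j : Fin k,
        EuclideanSpace.single j (1 : ℂ) ⊗ₜ[ℂ] EuclideanSpace.single j (1 : ℂ))) with hA
  have hentry (c : Fin n) : A ⟨0, hn⟩ c =
      ∑ j : Fin k, (if c.val = j.val then (1 : ℂ) else 0) •
        rowOperator k (EuclideanSpace.single j 1) := by
    rw [hA, map_sum, tensorIdFin_sum]
    refine Finset.sum_congr rfl fun j _ => ?_
    rw [TensorProduct.map_tmul, tensorIdFin_tmul_apply]
    have h1 : V' (V (EuclideanSpace.single j 1)) = EuclideanSpace.single j 1 := by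
      rw [← ContinuousLinearMap.comp_apply, hid, ContinuousLinearMap.id_apply]
    have h2 : rowMap k n (EuclideanSpace.single j 1) ⟨0, hn⟩ c =
        if c.val = j.val then 1 else 0 := by
      change rowMatrix k n (EuclideanSpace.single j 1) ⟨0, hn⟩ c = _
      rw [rowMatrix_single_apply]
      simp
    rw [h2, LinearMap.comp_apply, ContinuousLinearMap.coe_coe, ContinuousLinearMap.coe_coe, h1]
  -- The test vector is `∑ e_c ⊗ e_c` over `c < k`, of norm `√k`. Each of its `k` terms is sent to
  -- the same unit vector in block `0`, so they add up to norm `k`.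
  set v : PiLp 2 (fun _ : Fin n => L2 k) := WithLp.toLp 2 fun c =>
    if h : c.val < k then EuclideanSpace.single ⟨c, h⟩ 1 else 0 with hv
  have hvn : ‖v‖ = √k := by
    rw [PiLp.norm_eq_of_L2]
    congr 1
    have h1 (c : Fin n) : ‖v c‖ ^ 2 = if c.val < k then 1 else 0 := by
      simp only [hv]
      split_ifs <;> simp
    simp only [h1]
    rw [Fin.sum_univ_eq_sum_range (fun c => if c < k then (1 : ℝ) else 0) n, Finset.sum_boole]
    congr 1
    rw [← Finset.card_range k]
    congr 1
    ext c
    simp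
    lia
  have hval : operatorOfMatrix (CStarMatrix.ofMatrix.symm A) v ⟨0, hn⟩ =
      EuclideanSpace.single (⟨0, hk0⟩ : Fin k) (k : ℂ) := by
    rw [operatorOfMatrix_apply]
    simp only [CStarMatrix.ofMatrix_symm_apply, hentry, sum_apply, smul_apply]
    rw [Finset.sum_comm]
    have h1 (j : Fin k) : ∑ c : Fin n, (if c.val = j.val then (1 : ℂ) else 0) •
        rowOperator k (EuclideanSpace.single j 1) (v c) =
          EuclideanSpace.single (⟨0, hk0⟩ : Fin k) (1 : ℂ) := by
      rw [Finset.sum_eq_single (Fin.castLE hk j)]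
      · have : v (Fin.castLE hk j) = EuclideanSpace.single j 1 := by simp [hv]
        rw [this, rowOperator_apply hk0]
        simp
      · intro c _ hc
        rw [if_neg fun h : c.val = j.val => hc (Fin.ext h), zero_smul]
      · simp
    simp only [h1]
    ext r
    simp
  have hle : (k : ℝ) ≤ ‖A‖ * √k := by
    calc (k : ℝ) = ‖operatorOfMatrix (CStarMatrix.ofMatrix.symm A) v ⟨0, hn⟩‖ := by
          rw [hval, PiLp.norm_single]
          simp
      _ ≤ ‖operatorOfMatrix (CStarMatrix.ofMatrix.symm A) v‖ := PiLp.norm_apply_le _ _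
      _ ≤ ‖A‖ * ‖v‖ := norm_operatorOfMatrix_apply_le _ v
      _ = _ := by rw [hvn]
  have hk' : 0 < √(k : ℝ) := Real.sqrt_pos.2 (by exact_mod_cast hk0)
  refine le_of_mul_le_mul_right ?_ hk'
  rwa [Real.mul_self_sqrt (Nat.cast_nonneg k)]

end Tensor

/-! ### Choice of constants and conclusion -/

theorem mainTheorem2 :
    ∃ δ C K c : ℝ, 0 < δ ∧ δ < 1 / 2 ∧ 0 < C ∧ 0 < K ∧ 0 < c ∧
      ∀ n : ℕ, 2 ≤ n → ∃ F : L1LInf n n ⊗[ℂ] BFin n,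
        0 < injNorm F ∧
        c * (√(n : ℝ) / √(Real.log n)) ≤ minNorm (l1LInfMatrixNorms n n) F / injNorm F ∧
        ∀ k : ℕ, k = ⌊δ * n⌋₊ → 1 ≤ k →
          ∃ (V : L2 k →L[ℂ] L1LInf n n) (V' : L1LInf n n →L[ℂ] L2 k),
            ‖V‖ ≤ C * √(Real.log n) ∧ ‖V'‖ ≤ 1 ∧
            V' ∘L V = ContinuousLinearMap.id ℂ (L2 k) ∧
            CBNormLE (l1LInfMatrixNorms n n) (rowMatrixNorms k) V'.toLinearMap K ∧
            F = TensorProduct.map V.toLinearMap (rowMap k n)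
              (∑ j : Fin k, EuclideanSpace.single j (1 : ℂ) ⊗ₜ[ℂ] EuclideanSpace.single j (1 : ℂ)) := by
  refine ⟨1 / 4, 12, 1, 1 / 36, by norm_num, by norm_num, by norm_num, by norm_num, by norm_num,
    fun n hn => ?_⟩
  have hn0 : 0 < n := by lia
  have hnR : (0 : ℝ) < n := by exact_mod_cast hn0
  have hlog : 0 < Real.log n := Real.log_pos (by exact_mod_cast hn)
  -- The maximum with `1` provides a nonzero tensor also when the floor vanishes (`n < 4`), where
  -- only the ratio bound is required.
  obtain ⟨k, hkdef⟩ : ∃ k, k = max 1 ⌊(1 / 4 : ℝ) * n⌋₊ := ⟨_, rfl⟩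
  have hk0 : 0 < k := by rw [hkdef]; exact lt_max_of_lt_left one_pos
  have hk : k ≤ n := by
    rw [hkdef]
    refine max_le hn0 (Nat.floor_le_of_le ?_)
    linarith
  -- The divisor `9` is a convenient perfect square: `√(n/9) = √n / 3`, and division by `12 √log n`
  -- gives `c = 1/36`.
  have hkn : (n : ℝ) / 9 ≤ k := by
    have h1 : (1 : ℝ) ≤ k := by exact_mod_cast hk0
    have h2 : (1 / 4 : ℝ) * n < ⌊(1 / 4 : ℝ) * n⌋₊ + 1 := Nat.lt_floor_add_one _
    have h3 : (⌊(1 / 4 : ℝ) * n⌋₊ : ℝ) ≤ k := by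
      rw [hkdef]
      exact_mod_cast le_max_right _ _
    linarith
  obtain ⟨s, hs⟩ := exists_signs_sum_norm_sq_le hn hk (fun j a => dftEntry n j a)
    (fun j a => (norm_dftEntry n j a).le)
  have hid := frameAnalysis_comp_frameSynthesis hn0 hk s
  have hV' := norm_frameAnalysis_le hn0 hk0 hk s
  have hV : ‖frameSynthesis s‖ ≤ 12 * √(Real.log n) := by
    -- `B ^ 2 = 36 n² log n` rounds `32` up to a square, and `2 * B / n` yields the constant `12`.
    have h1 := norm_frameSynthesis_le hn0 s (B := 6 * n * √(Real.log n)) (by positivity)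
      fun a e => (hs a e).trans (by
        rw [mul_pow, mul_pow, Real.sq_sqrt hlog.le]
        nlinarith [mul_pos (pow_pos hnR 2) hlog])
    refine h1.trans_eq ?_
    field_simp
    norm_num
  have hinj := (injNorm_entangled_le (frameSynthesis s) (rowMap k n) (norm_rowMap_le hk)).trans hV
  have hinj1 := one_le_injNorm_entangled hk0 hk (frameSynthesis s) (frameAnalysis s) hV' hid
  have hmin := sqrt_le_minNorm_entangled hk0 hk (l1LInfMatrixNorms n n) (frameSynthesis s)
    (frameAnalysis s) hid (isCompleteContraction_frameAnalysis hn0 hk0 hk s)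
  refine ⟨_, zero_lt_one.trans_le hinj1, ?_, ?_⟩
  · rw [le_div_iff₀ (zero_lt_one.trans_le hinj1)]
    have hsl : 0 < √(Real.log n) := Real.sqrt_pos.2 hlog
    calc _ ≤ 1 / 36 * (√n / √(Real.log n)) * (12 * √(Real.log n)) := by gcongr
      _ = √(n : ℝ) / 3 := by field_simp; norm_num
      _ = √((n : ℝ) / 9) := by
          rw [Real.sqrt_div hnR.le, show (9 : ℝ) = 3 ^ 2 by norm_num, Real.sqrt_sq (by norm_num)]
      _ ≤ √k := Real.sqrt_le_sqrt hkn
      _ ≤ _ := hmin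
  · intro k' hk' hk'1
    obtain rfl : k' = k := by rw [hkdef, ← hk', max_eq_right hk'1]
    exact ⟨frameSynthesis s, frameAnalysis s, hV, hV', hid,
      cbNormLE_frameAnalysis hn0 hk0 hk s, rfl⟩
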